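/- Let $H$ be an arbitrary (possibly unbounded) self-adjoint operator on $L^2(\mathbb R^3)$, let $e^{-itH}$ be the unitary group it generates, and let $R_H(z)=(H-z)^{-1}$ for $z\in\mathbb C\setminus\mathbb R$. Let $\varphi:\mathbb R^3\to[0,\infty)$ be a weight function, that is, $\varphi(x)\le\varphi(y)$ whenever $\|x\|\le\|y\|$, and $\varphi(x)\to+\infty$ as $\|x\|\to\infty$; let $\varphi(X)$ and $\varphi^{1/2}$ denote multiplication by $\varphi(x)$ and by $\varphi(x)^{1/2}$. For $u\in L^2(\mathbb R^3)$ put $\langle u,\varphi(X)u\rangle=\int_{\mathbb R^3}\varphi(x)|u(x)|^2\,dx\in[0,\infty]$, and let $\|\varphi^{1/2}u\|\in[0,\infty]$ be the $L^2$-norm of $\varphi^{1/2}u$, with value $+\infty$ if $\varphi^{1/2}u\notin L^2(\mathbb R^3)$. Then for every $T>0$ and every $\psi\in L^2(\mathbb R^3)$, $$\frac1T\int_0^\infty e^{-t/T}\,\langle e^{-itH}\psi,\varphi(X)e^{-itH}\psi\rangle\,dt=\frac1{2\pi T}\int_{-\infty}^{\infty}\Big\|\varphi^{1/2}R_H\Big(E+\frac{i}{2T}\Big)\psi\Big\|^2\,dE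 ,$$ as an equality in $[0,\infty]$; in particular, one side is finite if and only if the other is. -/

import Mathlib

open MeasureTheory Filter

noncomputable section

namespace QuantumTransport

/-- The configuration space `ℝ³` with its Euclidean norm. -/
abbrev R3 : Type := EuclideanSpace ℝ (Fin 3)

/-- The Hilbert space `L²(ℝ³)` of complex-valued functions, with respect to Lebesgue measure. -/
abbrev L2R3 : Type := Lp ℂ 2 (volume : Measure R3)

section Operators

variable {𝓗 : Type*} [NormedAddCommGroup 𝓗] [InnerProductSpace ℂ 𝓗]

/-- `U` is the unitary group `t ↦ e^{-itH}`: a strongly continuous one-parameter group of unitary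
operators whose generator is exactly `-iH`. The last field says that `ψ` lies in the domain of `H`
with `H ψ = η` if and only if `t ↦ U t ψ` is differentiable at `0` with derivative `-iη`. -/
structure IsUnitaryGroupOf [CompleteSpace 𝓗] (H : 𝓗 →ₗ.[ℂ] 𝓗) (U : ℝ → 𝓗 →L[ℂ] 𝓗) : Prop where
  unitary_mem : ∀ t, U t ∈ unitary (𝓗 →L[ℂ] 𝓗)
  map_zero : U 0 = 1
  map_add : ∀ s t, U (s + t) = U s * U t
  strongly_continuous : ∀ ψ, Continuous fun t => U t ψ
  generator : ∀ ψ η, (ψ, η) ∈ H.graph ↔ HasDerivAt (fun t => U t ψ) (-Complex.I • η) 0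

/-- The unitary group generated by a densely defined operator is unique. -/
theorem IsUnitaryGroupOf.unique [CompleteSpace 𝓗] {H : 𝓗 →ₗ.[ℂ] 𝓗} (hH : Dense (H.domain : Set 𝓗))
    {U V : ℝ → 𝓗 →L[ℂ] 𝓗} (hU : IsUnitaryGroupOf H U) (hV : IsUnitaryGroupOf H V) : U = V := by
  -- invariance of the domain and the equation of motion along an orbit
  have key : ∀ {W : ℝ → 𝓗 →L[ℂ] 𝓗}, IsUnitaryGroupOf H W → ∀ {ψ η : 𝓗}, (ψ, η) ∈ H.graph →
      ∀ t, (W t ψ, W t η) ∈ H.graph ∧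
        HasDerivAt (fun s => W s ψ) (-Complex.I • W t η) t := by
    intro W hW ψ η h t
    have h0 := (hW.generator ψ η).1 h
    have h1 : HasDerivAt (fun s => W t (W s ψ)) (-Complex.I • W t η) 0 := by
      have := ((W t).restrictScalars ℝ).hasFDerivAt.comp_hasDerivAt (0 : ℝ) h0
      simpa [Function.comp_def] using this
    constructor
    · rw [hW.generator]
      have e : (fun s => W s (W t ψ)) = fun s => W t (W s ψ) := by
        funext s
        rw [← mul_apply_eq_comp, ← mul_apply_eq_comp, ← hW.map_add,
          ← hW.map_add, add_comm]
      rwa [e]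
    · have e : (fun s => W s ψ) = fun s => W t (W (s - t) ψ) := by
        funext s
        rw [← mul_apply_eq_comp, ← hW.map_add]
        congr 2
        ring
      rw [e]
      exact HasDerivAt.comp_sub_const t t (f := fun s => W t (W s ψ)) (by simpa using h1)
  have norm_U : ∀ s w, ‖U s w‖ = ‖w‖ := fun s w =>
    ContinuousLinearMap.norm_map_of_mem_unitary (hU.unitary_mem s) w
  -- the difference of two orbits has constant norm
  have main : ∀ ψ ∈ H.domain, ∀ t, U t ψ = V t ψ := by
    intro ψ hψ t
    have hg : (ψ, H ⟨ψ, hψ⟩) ∈ H.graph := H.mem_graph ⟨ψ, hψ⟩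
    set η := H ⟨ψ, hψ⟩
    have hd : ∀ s, HasDerivAt (fun s => ‖U s ψ - V s ψ‖ ^ 2) 0 s := by
      intro s
      obtain ⟨gU, dU⟩ := key hU hg s
      obtain ⟨gV, dV⟩ := key hV hg s
      have gw : (U s ψ - V s ψ, U s η - V s η) ∈ H.graph := H.graph.sub_mem gU gV
      have d1 := ((hU.generator _ _).1 gw)
      let _ : InnerProductSpace ℝ 𝓗 := InnerProductSpace.rclikeToReal ℂ 𝓗
      have d2 := d1.norm_sq
      simp only [norm_U, hU.map_zero, one_apply_eq_self] at d2
      have d3 := (dU.sub dV).norm_sq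
      have z := (hasDerivAt_const (0 : ℝ) (‖U s ψ - V s ψ‖ ^ 2)).unique d2
      rw [← smul_sub] at d3
      simp only [Pi.sub_apply] at d3
      rw [← z] at d3
      exact d3
    have hc := is_const_of_deriv_eq_zero (fun s => (hd s).differentiableAt)
      (fun s => (hd s).deriv) t 0
    simp only [hU.map_zero, hV.map_zero, sub_self, norm_zero] at hc
    rw [← sub_eq_zero, ← norm_eq_zero]
    simpa using hc
  funext t
  exact ContinuousLinearMap.ext fun ψ =>
    congrFun ((U t).continuous.ext_on hH (V t).continuous fun x hx => main x hx t) ψ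

open Classical in
/-- The propagator `e^{-itH}`, i.e. the one-parameter unitary group with generator `-iH`
(for self-adjoint `H` it exists and is unique, by Stone's theorem; the value `0` is used for
operators `H` that generate no unitary group). -/
def propagator [CompleteSpace 𝓗] (H : 𝓗 →ₗ.[ℂ] 𝓗) : ℝ → 𝓗 →L[ℂ] 𝓗 :=
  if h : ∃ U : ℝ → 𝓗 →L[ℂ] 𝓗, IsUnitaryGroupOf H U then h.choose else 0

/-- `R` is the bounded everywhere defined inverse of `H - z`: one has `R ψ = u` if and only if
`u` lies in the domain of `H` and `H u = ψ + z u`. -/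
def IsResolventAt (H : 𝓗 →ₗ.[ℂ] 𝓗) (z : ℂ) (R : 𝓗 →L[ℂ] 𝓗) : Prop :=
  ∀ ψ u : 𝓗, R ψ = u ↔ (u, ψ + z • u) ∈ H.graph

/-- The resolvent at a point is unique. -/
theorem IsResolventAt.unique {H : 𝓗 →ₗ.[ℂ] 𝓗} {z : ℂ} {R S : 𝓗 →L[ℂ] 𝓗}
    (hR : IsResolventAt H z R) (hS : IsResolventAt H z S) : R = S :=
  ContinuousLinearMap.ext fun ψ => (hR ψ (S ψ)).2 ((hS ψ (S ψ)).1 rfl)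

open Classical in
/-- The resolvent `R_H(z) = (H - z)⁻¹` as a bounded operator, for `z` in the resolvent set of `H`
(which contains all non-real `z` if `H` is self-adjoint); the value is `0` for all other `z`. -/
def resolventOp (H : 𝓗 →ₗ.[ℂ] 𝓗) (z : ℂ) : 𝓗 →L[ℂ] 𝓗 :=
  if h : ∃ R : 𝓗 →L[ℂ] 𝓗, IsResolventAt H z R then h.choose else 0

end Operators

/-- Weight functions on `ℝ³`: nonnegative, monotonically increasing (in `‖x‖`, as for
`⟨x⟩^q = (1 + ‖x‖²)^{q/2}`), and tending to `+∞` as `‖x‖ → ∞`. -/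
structure IsWeight (φ : R3 → ℝ) : Prop where
  nonneg : ∀ x, 0 ≤ φ x
  mono : ∀ x y, ‖x‖ ≤ ‖y‖ → φ x ≤ φ y
  tendsto_atTop : Tendsto φ (cocompact R3) atTop

/-- The expectation `⟨u, φ(X) u⟩ = ∫ φ(x) |u(x)|² dx ∈ [0, ∞]`, where `φ(X)` is multiplication by
`φ ≥ 0`, in the sense of quadratic forms: it is `+∞` when `u` is not in the form domain
of `φ(X)`. -/
def weightExpectation (φ : R3 → ℝ) (u : L2R3) : ENNReal :=
  ∫⁻ x, ENNReal.ofReal (φ x * ‖u x‖ ^ 2)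

/-- The norm `‖φ^{1/2} u‖ ∈ [0, ∞]` in `L²(ℝ³)` of the product of `φ^{1/2}` and `u`; it is `+∞`
when `φ^{1/2} u` is not square integrable. -/
def sqrtWeightNorm (φ : R3 → ℝ) (u : L2R3) : ENNReal :=
  eLpNorm (fun x => (Real.sqrt (φ x) : ℂ) * u x) 2 (volume : Measure R3)

/-- The averaged `φ`-moment of the position operator,
`(1/T) ∫₀^∞ e^{-t/T} ⟨e^{-itH} ψ, φ(X) e^{-itH} ψ⟩ dt ∈ [0, ∞]`. -/
def averagedMoment (H : L2R3 →ₗ.[ℂ] L2R3) (φ : R3 → ℝ) (ψ : L2R3) (T : ℝ) : ENNReal :=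
  ENNReal.ofReal (1 / T) * ∫⁻ t in Set.Ioi (0 : ℝ),
    ENNReal.ofReal (Real.exp (-(t / T))) * weightExpectation φ (propagator H t ψ)

end QuantumTransport

end

open scoped Topology ComplexConjugate InnerProductSpace

namespace QuantumTransport

/-! ### Resolvents of a self-adjoint operator, through its graph. -/

section Resolvent

variable {𝓗 : Type*} [NormedAddCommGroup 𝓗] [InnerProductSpace ℂ 𝓗] [CompleteSpace 𝓗]
  {H : 𝓗 →ₗ.[ℂ] 𝓗}

/-! The identity is Plancherel's theorem in the time variable. Put `ε = 1/(2T)`. For a bounded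
operator `A`, the function equal to `e^{-εt} A e^{-itH} ψ` on `t > 0` and to `0` elsewhere lies in
L¹ ∩ L². Since the resolvent is the Laplace transform of the group
(`IsUnitaryGroupOf.integral_exp_smul`), its Fourier transform is, up to a unimodular factor, `A
R_H(E + iε) ψ` with `E = -2πw`. Hilbert-space-valued Plancherel (`lintegral_enorm_fourier_sq`) then
gives `IsUnitaryGroupOf.lintegral_exp_mul_enorm_sq`.

An unbounded weight is reached by truncation: multiplication by the square root of `min φ n` is
bounded, and monotone convergence on both sides gives equality in `[0, ∞]` with no domain condition
on `ψ`.

Because `propagator` and `resolventOp` are chosen with default value `0`, existence must be proved: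
`exists_isResolventAt` for the resolvent, and Stone's theorem `exists_isUnitaryGroupOf`, by Yosida
approximation, for the group. -/

theorem mem_graph_iff_of_isSelfAdjoint (hH : IsSelfAdjoint H) {x y : 𝓗} :
    (x, y) ∈ H.graph ↔ ∀ a b, (a, b) ∈ H.graph → inner ℂ b x = inner ℂ a y := by
  conv_lhs => rw [← LinearPMap.isSelfAdjoint_def.mp hH,
    LinearPMap.adjoint_graph_eq_graph_adjoint hH.dense_domain, Submodule.mem_adjoint_iff]
  simp only [sub_eq_zero]

/-- As `⟨u, Hu⟩` is real, the imaginary part of `⟨u, (H - z)u⟩` is `-(Im z)‖u‖²`; Cauchy–Schwarz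
does the rest. -/
theorem abs_im_mul_norm_le (hH : IsSelfAdjoint H) {u w : 𝓗} (h : (u, w) ∈ H.graph) (z : ℂ) :
    |z.im| * ‖u‖ ≤ ‖w - z • u‖ := by
  have h1 : inner ℂ w u = inner ℂ u w := (mem_graph_iff_of_isSelfAdjoint hH).1 h _ _ h
  have h2 : (inner ℂ u w).im = 0 := by
    rw [← inner_conj_symm] at h1
    exact Complex.conj_eq_iff_im.1 h1
  have h3 : (inner ℂ u (w - z • u)).im = -(z.im * ‖u‖ ^ 2) := by
    rw [inner_sub_right, inner_smul_right, inner_self_eq_norm_sq_to_K, Complex.sub_im, h2,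
      RCLike.ofReal_eq_complex_ofReal, ← Complex.ofReal_pow, Complex.im_mul_ofReal, zero_sub]
  rcases eq_or_ne u 0 with rfl | hu
  · simp
  have hu' : 0 < ‖u‖ := norm_pos_iff.2 hu
  have h4 : |z.im| * ‖u‖ ^ 2 ≤ ‖u‖ * ‖w - z • u‖ := by
    calc |z.im| * ‖u‖ ^ 2 = |(inner ℂ u (w - z • u)).im| := by
          rw [h3, abs_neg, abs_mul, abs_of_nonneg (sq_nonneg ‖u‖)]
      _ ≤ ‖inner ℂ u (w - z • u)‖ := Complex.abs_im_le_norm _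
      _ ≤ _ := norm_inner_le_norm _ _
  nlinarith

/-- `H - z` is bounded below and its graph is complete, so its range is closed. The range is also
dense: a vector orthogonal to it is an eigenvector of `H* = H` for `conj z`, hence zero by the same
bound. -/
theorem exists_mem_graph_add_smul (hH : IsSelfAdjoint H) {z : ℂ} (hz : z.im ≠ 0) (ψ : 𝓗) :
    ∃ u, (u, ψ + z • u) ∈ H.graph := by
  let L : (𝓗 × 𝓗) →L[ℂ] 𝓗 :=
    ContinuousLinearMap.snd ℂ 𝓗 𝓗 - z • ContinuousLinearMap.fst ℂ 𝓗 𝓗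
  let f : H.graph →L[ℂ] 𝓗 := L.comp H.graph.subtypeL
  have hf : ∀ p : H.graph, f p = (p : 𝓗 × 𝓗).2 - z • (p : 𝓗 × 𝓗).1 := fun p => rfl
  have hz' : 0 < |z.im| := abs_pos.2 hz
  have hanti : AntilipschitzWith (Real.toNNReal (1 / |z.im| + 1 + ‖z‖ / |z.im|)) f := by
    refine AddMonoidHomClass.antilipschitz_of_bound f fun p => ?_
    rw [Real.coe_toNNReal _ (by positivity)]
    obtain ⟨⟨u, w⟩, hp⟩ := p
    have hb := abs_im_mul_norm_le hH hp z
    have h1 : ‖u‖ ≤ ‖w - z • u‖ / |z.im| := by rw [le_div_iff₀ hz', mul_comm]; exact hb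
    have h2 : ‖w‖ ≤ ‖w - z • u‖ + ‖z‖ * ‖u‖ := by
      calc ‖w‖ = ‖(w - z • u) + z • u‖ := by simp
        _ ≤ _ := (norm_add_le _ _).trans (by rw [norm_smul])
    have h3 : ‖z‖ * ‖u‖ ≤ ‖z‖ * (‖w - z • u‖ / |z.im|) := by gcongr
    have h4 : 0 ≤ ‖z‖ * (‖w - z • u‖ / |z.im|) := by positivity
    have h5 : (1 / |z.im| + 1 + ‖z‖ / |z.im|) * ‖w - z • u‖ =
        ‖w - z • u‖ / |z.im| + ‖w - z • u‖ + ‖z‖ * (‖w - z • u‖ / |z.im|) := by ring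
    rw [hf]
    change max ‖u‖ ‖w‖ ≤ (1 / |z.im| + 1 + ‖z‖ / |z.im|) * ‖w - z • u‖
    rw [h5]
    have h6 : 0 ≤ ‖w - z • u‖ / |z.im| := by positivity
    exact max_le (by linarith [norm_nonneg (w - z • u)]) (by linarith)
  have : CompleteSpace H.graph := hH.isClosed.completeSpace_coe
  have hclosed : IsClosed (Set.range f) := hanti.isClosed_range f.uniformContinuous
  let S : Submodule ℂ 𝓗 := LinearMap.range (f : H.graph →ₗ[ℂ] 𝓗)
  have hS : IsClosed (S : Set 𝓗) := hclosed
  have hperp : Sᗮ = ⊥ := by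
    rw [Submodule.eq_bot_iff]
    intro v hv
    rw [Submodule.mem_orthogonal] at hv
    have hg : (v, conj z • v) ∈ H.graph := by
      rw [mem_graph_iff_of_isSelfAdjoint hH]
      intro a b hab
      have := hv (f ⟨(a, b), hab⟩) ⟨_, rfl⟩
      rw [hf, inner_sub_left, inner_smul_left, sub_eq_zero] at this
      rw [this, inner_smul_right]
    have := abs_im_mul_norm_le hH hg (conj z)
    rw [sub_self, norm_zero, Complex.conj_im, abs_neg] at this
    have h0 : ‖v‖ ≤ 0 := by
      by_contra hc
      push Not at hc
      nlinarith
    simpa using h0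
  have htop : S = ⊤ := by
    rw [← hS.submodule_topologicalClosure_eq]
    exact (Submodule.topologicalClosure_eq_top_iff).2 hperp
  have hmem : ψ ∈ S := htop ▸ Submodule.mem_top
  obtain ⟨⟨⟨u, w⟩, hp⟩, h⟩ := hmem
  refine ⟨u, ?_⟩
  have : ψ + z • u = w := by
    rw [← h]
    change w - z • u + z • u = w
    simp
  rwa [this]

theorem mem_graph_add_smul_unique (hH : IsSelfAdjoint H) {z : ℂ} (hz : z.im ≠ 0) {ψ u v : 𝓗}
    (hu : (u, ψ + z • u) ∈ H.graph) (hv : (v, ψ + z • v) ∈ H.graph) : u = v := by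
  have h := H.graph.sub_mem hu hv
  have h1 := abs_im_mul_norm_le hH (u := u - v) (w := (ψ + z • u) - (ψ + z • v)) h z
  have h2 : (ψ + z • u) - (ψ + z • v) - z • (u - v) = 0 := by
    rw [smul_sub]; abel
  rw [h2, norm_zero] at h1
  have hz' : 0 < |z.im| := abs_pos.2 hz
  have h0 : ‖u - v‖ ≤ 0 := by
    by_contra hc
    push Not at hc
    nlinarith
  exact sub_eq_zero.1 (norm_le_zero_iff.1 h0)

theorem exists_isResolventAt (hH : IsSelfAdjoint H) {z : ℂ} (hz : z.im ≠ 0) :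
    ∃ R : 𝓗 →L[ℂ] 𝓗, IsResolventAt H z R := by
  choose r hr using exists_mem_graph_add_smul hH hz
  have huniq : ∀ {ψ u}, (u, ψ + z • u) ∈ H.graph → r ψ = u := fun h =>
    mem_graph_add_smul_unique hH hz (hr _) h
  let R₀ : 𝓗 →ₗ[ℂ] 𝓗 :=
    { toFun := r
      map_add' := fun a b => huniq (by
        have h := H.graph.add_mem (hr a) (hr b)
        have e : a + b + z • (r a + r b) = (a + z • r a) + (b + z • r b) := by
          rw [smul_add]; abel
        rw [e]; exact h)
      map_smul' := fun c a => huniq (by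
        have h := H.graph.smul_mem c (hr a)
        have e : c • a + z • c • r a = c • (a + z • r a) := by
          rw [smul_add, smul_comm z c]
        simp only [RingHom.id_apply]
        rw [e]; exact h) }
  have hz' : 0 < |z.im| := abs_pos.2 hz
  refine ⟨R₀.mkContinuous (1 / |z.im|) fun ψ => ?_, fun ψ u => ⟨?_, fun h => huniq h⟩⟩
  · have := abs_im_mul_norm_le hH (hr ψ) z
    rw [add_sub_cancel_right] at this
    change ‖r ψ‖ ≤ _
    rw [div_mul_eq_mul_div, one_mul, le_div_iff₀ hz', mul_comm]
    exact this
  · rintro rfl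
    exact hr ψ

theorem isResolventAt_resolventOp (hH : IsSelfAdjoint H) {z : ℂ} (hz : z.im ≠ 0) :
    IsResolventAt H z (resolventOp H z) := by
  have h := exists_isResolventAt hH hz
  rw [resolventOp, dif_pos h]
  exact h.choose_spec

theorem resolventOp_mem_graph (hH : IsSelfAdjoint H) {z : ℂ} (hz : z.im ≠ 0) (ψ : 𝓗) :
    (resolventOp H z ψ, ψ + z • resolventOp H z ψ) ∈ H.graph :=
  (isResolventAt_resolventOp hH hz ψ _).1 rfl

theorem abs_im_mul_norm_resolventOp_le (hH : IsSelfAdjoint H) {z : ℂ} (hz : z.im ≠ 0) (ψ : 𝓗) :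
    |z.im| * ‖resolventOp H z ψ‖ ≤ ‖ψ‖ := by
  simpa using abs_im_mul_norm_le hH (resolventOp_mem_graph hH hz ψ) z

theorem resolventOp_apply_of_mem_graph (hH : IsSelfAdjoint H) {z : ℂ} (hz : z.im ≠ 0) {u w : 𝓗}
    (h : (u, w) ∈ H.graph) : resolventOp H z w = u + z • resolventOp H z u := by
  have h1 : resolventOp H z (w - z • u) = u :=
    (isResolventAt_resolventOp hH hz _ _).2 (by simpa using h)
  rw [map_sub, map_smul, sub_eq_iff_eq_add] at h1
  exact h1

theorem resolventOp_mem_graph_of_mem_graph (hH : IsSelfAdjoint H) {z : ℂ} (hz : z.im ≠ 0)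
    {u w : 𝓗} (h : (u, w) ∈ H.graph) : (resolventOp H z u, resolventOp H z w) ∈ H.graph := by
  rw [resolventOp_apply_of_mem_graph hH hz h]
  exact resolventOp_mem_graph hH hz u

/-- A resolvent maps the graph of `H` into itself, so `R(z)R(w)ψ` solves the equation that
characterises `R(w)R(z)ψ`. -/
theorem commute_resolventOp (hH : IsSelfAdjoint H) {z w : ℂ} (hz : z.im ≠ 0) (hw : w.im ≠ 0) :
    Commute (resolventOp H z) (resolventOp H w) := by
  ext ψ
  refine ((isResolventAt_resolventOp hH hw _ _).2 ?_).symm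
  have := resolventOp_mem_graph_of_mem_graph hH hz (resolventOp_mem_graph hH hw ψ)
  rwa [map_add, map_smul] at this

theorem adjoint_resolventOp (hH : IsSelfAdjoint H) {z : ℂ} (hz : z.im ≠ 0) :
    star (resolventOp H z) = resolventOp H (conj z) := by
  have hz' : (conj z).im ≠ 0 := by simpa using hz
  rw [ContinuousLinearMap.star_eq_adjoint]
  symm
  rw [ContinuousLinearMap.eq_adjoint_iff]
  intro a b
  have h := (mem_graph_iff_of_isSelfAdjoint hH).1 (resolventOp_mem_graph hH hz b) _ _
    (resolventOp_mem_graph hH hz' a)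
  rw [inner_add_left, inner_add_right, inner_smul_left, inner_smul_right, Complex.conj_conj] at h
  exact (add_right_cancel h).symm

end Resolvent

/-! ### Stone's theorem by Yosida approximation. -/

section Stone

open NormedSpace

variable {𝓗 : Type*} [NormedAddCommGroup 𝓗] [InnerProductSpace ℂ 𝓗] [CompleteSpace 𝓗]

theorem exp_smul_mem_unitary {A : 𝓗 →L[ℂ] 𝓗} (hA : A ∈ skewAdjoint (𝓗 →L[ℂ] 𝓗)) (t : ℝ) :
    exp (t • A) ∈ unitary (𝓗 →L[ℂ] 𝓗) := by
  let _ : NormedAlgebra ℚ (𝓗 →L[ℂ] 𝓗) := .restrictScalars ℚ ℂ _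
  exact exp_mem_unitary_of_mem_skewAdjoint (skewAdjoint.smul_mem t hA)

theorem norm_exp_smul_apply {A : 𝓗 →L[ℂ] 𝓗} (hA : A ∈ skewAdjoint (𝓗 →L[ℂ] 𝓗)) (t : ℝ)
    (x : 𝓗) : ‖exp (t • A) x‖ = ‖x‖ :=
  ContinuousLinearMap.norm_map_of_mem_unitary (exp_smul_mem_unitary hA t) x

theorem hasDerivAt_exp_smul_apply (A : 𝓗 →L[ℂ] 𝓗) (x : 𝓗) (t : ℝ) :
    HasDerivAt (fun s : ℝ => exp (s • A) x) (exp (t • A) (A x)) t := by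
  have h := hasDerivAt_exp_smul_const (𝕂 := ℝ) A t
  have h2 := ((ContinuousLinearMap.apply ℂ 𝓗 x).restrictScalars ℝ).hasFDerivAt.comp_hasDerivAt t h
  exact h2

theorem norm_exp_smul_apply_sub_le {A : 𝓗 →L[ℂ] 𝓗} (hA : A ∈ skewAdjoint (𝓗 →L[ℂ] 𝓗)) (t : ℝ)
    (x : 𝓗) : ‖exp (t • A) x - x‖ ≤ |t| * ‖A x‖ := by
  have h := Convex.norm_image_sub_le_of_norm_hasDerivWithin_le (s := Set.univ) (x := (0 : ℝ))
    (y := t) (f := fun s : ℝ => exp (s • A) x) (f' := fun s => exp (s • A) (A x)) (C := ‖A x‖)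
    (fun s _ => (hasDerivAt_exp_smul_apply A x s).hasDerivWithinAt)
    (fun s _ => (norm_exp_smul_apply hA s _).le) convex_univ trivial trivial
  simpa [mul_comm] using h

/-- By commutativity the unitary `exp (t • B)` factors out, leaving the displacement of `x` under
`exp (t • (A - B))`. -/
theorem norm_exp_smul_apply_sub_exp_smul_apply_le {A B : 𝓗 →L[ℂ] 𝓗}
    (hA : A ∈ skewAdjoint (𝓗 →L[ℂ] 𝓗)) (hB : B ∈ skewAdjoint (𝓗 →L[ℂ] 𝓗)) (hAB : Commute A B)
    (t : ℝ) (x : 𝓗) : ‖exp (t • A) x - exp (t • B) x‖ ≤ |t| * ‖A x - B x‖ := by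
  let _ : NormedAlgebra ℚ (𝓗 →L[ℂ] 𝓗) := .restrictScalars ℚ ℂ _
  have hc : Commute (t • B) (t • (A - B)) :=
    ((hAB.symm.sub_right (Commute.refl B)).smul_left t).smul_right t
  have h : exp (t • A) = exp (t • B) * exp (t • (A - B)) := by
    rw [← exp_add_of_commute hc, ← smul_add, add_sub_cancel]
  rw [h, mul_apply_eq_comp, ← map_sub, norm_exp_smul_apply hB]
  exact norm_exp_smul_apply_sub_le (sub_mem hA hB) t x

/-- Orbits of the exponentials of commuting skew-adjoint operators converge, if the operators
converge strongly on a dense set. -/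
theorem tendsto_exp_smul_apply {A : ℕ → 𝓗 →L[ℂ] 𝓗}
    (hA : ∀ n, A n ∈ skewAdjoint (𝓗 →L[ℂ] 𝓗)) (hc : ∀ m n, Commute (A m) (A n)) {D : Set 𝓗}
    (hD : Dense D) (hlim : ∀ x ∈ D, ∃ y, Tendsto (fun n => A n x) atTop (𝓝 y)) (t : ℝ) (x : 𝓗) :
    ∃ y, Tendsto (fun n => exp (t • A n) x) atTop (𝓝 y) := by
  refine cauchySeq_tendsto_of_complete ?_
  rw [Metric.cauchySeq_iff]
  intro ε hε
  obtain ⟨x', hx', hxx⟩ := Metric.dense_iff.1 hD x (ε / 3) (by positivity)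
  obtain ⟨y, hy⟩ := hlim x' hxx
  obtain ⟨N, hN⟩ := Metric.cauchySeq_iff.1 hy.cauchySeq (ε / 3 / (|t| + 1)) (by positivity)
  refine ⟨N, fun m hm n hn => ?_⟩
  have h1 := hN m hm n hn
  rw [dist_eq_norm, lt_div_iff₀ (by positivity)] at h1
  have h2 := norm_exp_smul_apply_sub_exp_smul_apply_le (hA m) (hA n) (hc m n) t x'
  rw [Metric.mem_ball, dist_comm, dist_eq_norm] at hx'
  have e : exp (t • A m) x - exp (t • A n) x = exp (t • A m) (x - x')
      + (exp (t • A m) x' - exp (t • A n) x') - exp (t • A n) (x - x') := by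
    rw [map_sub, map_sub]; abel
  rw [dist_eq_norm, e]
  calc _ ≤ ‖exp (t • A m) (x - x')‖ + ‖exp (t • A m) x' - exp (t • A n) x'‖
        + ‖exp (t • A n) (x - x')‖ := (norm_sub_le _ _).trans (by gcongr; exact norm_add_le _ _)
    _ < ε := by
        rw [norm_exp_smul_apply (hA m), norm_exp_smul_apply (hA n)]
        nlinarith [norm_nonneg (A m x' - A n x'), abs_nonneg t]

theorem exists_group_of_skewAdjoint_approx {A : ℕ → 𝓗 →L[ℂ] 𝓗}
    (hA : ∀ n, A n ∈ skewAdjoint (𝓗 →L[ℂ] 𝓗)) (hc : ∀ m n, Commute (A m) (A n)) {D : Set 𝓗}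
    (hD : Dense D) (hlim : ∀ x ∈ D, ∃ y, Tendsto (fun n => A n x) atTop (𝓝 y)) :
    ∃ U : ℝ → 𝓗 →L[ℂ] 𝓗, (∀ t, U t ∈ unitary (𝓗 →L[ℂ] 𝓗)) ∧ U 0 = 1 ∧
      (∀ s t, U (s + t) = U s * U t) ∧ (∀ x, Continuous fun t => U t x) ∧
      ∀ x y, Tendsto (fun n => A n x) atTop (𝓝 y) → HasDerivAt (fun t => U t x) y 0 := by
  let _ : NormedAlgebra ℚ (𝓗 →L[ℂ] 𝓗) := .restrictScalars ℚ ℂ _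
  choose u hu using tendsto_exp_smul_apply hA hc hD hlim
  have hu' : ∀ t, Tendsto (fun n x => exp (t • A n) x) atTop (𝓝 (u t)) := fun t =>
    tendsto_pi_nhds.2 (hu t)
  let U : ℝ → 𝓗 →L[ℂ] 𝓗 := fun t => continuousLinearMapOfTendsto _ (hu' t)
  have hU : ∀ t x, Tendsto (fun n => exp (t • A n) x) atTop (𝓝 (U t x)) := hu
  have hnorm : ∀ t x, ‖U t x‖ = ‖x‖ := fun t x => by
    refine tendsto_nhds_unique (hU t x).norm ?_
    simp only [norm_exp_smul_apply (hA _)]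
    exact tendsto_const_nhds
  have hzero : U 0 = 1 := by
    ext x
    refine tendsto_nhds_unique (hU 0 x) ?_
    simp
  have hadd : ∀ s t, U (s + t) = U s * U t := fun s t => by
    ext x
    have h1 : Tendsto (fun n => exp (s • A n) (exp (t • A n) x - U t x)) atTop (𝓝 0) := by
      rw [tendsto_zero_iff_norm_tendsto_zero]
      simp only [norm_exp_smul_apply (hA _)]
      exact tendsto_iff_norm_sub_tendsto_zero.1 (hU t x)
    have h2 := h1.add (hU s (U t x))
    rw [zero_add] at h2
    refine tendsto_nhds_unique (hU (s + t) x) (h2.congr fun n => ?_)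
    rw [map_sub, sub_add_cancel, add_smul, exp_add_of_commute
      (((Commute.refl (A n)).smul_left s).smul_right t), mul_apply_eq_comp]
  -- A strong limit of unitaries is a priori only isometric; this relation supplies the two-sided
  -- inverse.
  have hstar : ∀ t, star (U t) = U (-t) := fun t => by
    rw [ContinuousLinearMap.star_eq_adjoint]
    symm
    rw [ContinuousLinearMap.eq_adjoint_iff]
    intro a b
    refine tendsto_nhds_unique ((hU (-t) a).inner tendsto_const_nhds)
      (((tendsto_const_nhds (x := a)).inner (hU t b)).congr fun n => ?_)
    rw [← ContinuousLinearMap.adjoint_inner_left, ← ContinuousLinearMap.star_eq_adjoint, star_exp,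
      star_smul, skewAdjoint.mem_iff.1 (hA n)]
    simp
  have hderiv : ∀ x y, Tendsto (fun n => A n x) atTop (𝓝 y) →
      HasDerivAt (fun t => U t x) y 0 := by
    intro x y hxy
    -- The error is linear in `|t|` with a coefficient that is small for large `m`, so
    -- differentiability at `0` passes from one fixed `exp (t • A m)` to `U`.
    have hle : ∀ m t, ‖U t x - exp (t • A m) x‖ ≤ |t| * ‖y - A m x‖ := fun m t =>
      le_of_tendsto_of_tendsto ((hU t x).sub_const _).norm
        (((hxy.sub_const (A m x)).norm).const_mul |t|)
        (Eventually.of_forall fun n =>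
          norm_exp_smul_apply_sub_exp_smul_apply_le (hA n) (hA m) (hc n m) t x)
    rw [hasDerivAt_iff_isLittleO, Asymptotics.isLittleO_iff]
    intro c hc0
    obtain ⟨m, hm⟩ := ((Metric.tendsto_nhds.1 hxy) (c / 3) (by positivity)).exists
    rw [dist_comm, dist_eq_norm] at hm
    have hd := hasDerivAt_exp_smul_apply (A m) x 0
    rw [hasDerivAt_iff_isLittleO, Asymptotics.isLittleO_iff] at hd
    filter_upwards [hd (show 0 < c / 3 by positivity)] with t ht
    simp only [zero_smul, exp_zero, one_apply_eq_self, sub_zero, Real.norm_eq_abs, hzero] at ht ⊢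
    have e : U t x - x - t • y = (U t x - exp (t • A m) x) +
        (exp (t • A m) x - x - t • A m x) - t • (y - A m x) := by
      rw [smul_sub]; abel
    rw [e]
    have h3 : ‖t • (y - A m x)‖ = |t| * ‖y - A m x‖ := by rw [norm_smul, Real.norm_eq_abs]
    calc _ ≤ ‖U t x - exp (t • A m) x‖ + ‖exp (t • A m) x - x - t • A m x‖ + ‖t • (y - A m x)‖ :=
          (norm_sub_le _ _).trans (by gcongr; exact norm_add_le _ _)
      _ ≤ c * |t| := by nlinarith [hle m t, abs_nonneg t]
  have hcontD : ∀ x ∈ D, Continuous fun t => U t x := by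
    intro x hx
    obtain ⟨y, hy⟩ := hlim x hx
    rw [continuous_iff_continuousAt]
    intro t
    have h0 : ContinuousAt (fun s => U s x) (t - t) := by
      rw [sub_self]; exact (hderiv x y hy).continuousAt
    have h1 : ContinuousAt (fun s => U t (U (s - t) x)) t :=
      (U t).continuous.continuousAt.comp (h0.comp (f := fun s => s - t) (by fun_prop))
    refine h1.congr (Eventually.of_forall fun s => ?_)
    change U t (U (s - t) x) = U s x
    rw [← mul_apply_eq_comp, ← hadd, add_sub_cancel]
  refine ⟨U, fun t => ?_, hzero, hadd, fun x => ?_, hderiv⟩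
  · rw [Unitary.mem_iff, hstar, ← hadd, ← hadd]
    simp [hzero]
  -- Since each `U t` is isometric, orbits starting in `D` approximate every orbit uniformly in
  -- time.
  · refine continuous_of_uniform_approx_of_continuous fun V hV => ?_
    obtain ⟨ε, hε, hεV⟩ := Metric.mem_uniformity_dist.1 hV
    obtain ⟨x', hx', hxD⟩ := Metric.dense_iff.1 hD x ε hε
    refine ⟨fun t => U t x', hcontD x' hxD, fun t => hεV ?_⟩
    rw [dist_eq_norm, ← map_sub, hnorm, ← dist_eq_norm, dist_comm]
    exact hx'

variable {H : 𝓗 →ₗ.[ℂ] 𝓗}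

/-- On the domain `z R(z) y = R(z) H y - y`, and `R(z) → 0` in norm. On the imaginary axis `z R(z)`
has norm at most one, so the limit extends by density. -/
theorem tendsto_smul_resolventOp (hH : IsSelfAdjoint H) {z : ℕ → ℂ} (hre : ∀ n, (z n).re = 0)
    (him : ∀ n, (z n).im ≠ 0) (hz : Tendsto (fun n => |(z n).im|) atTop atTop) (x : 𝓗) :
    Tendsto (fun n => z n • resolventOp H (z n) x) atTop (𝓝 (-x)) := by
  have hnz : ∀ n, ‖z n‖ = |(z n).im| := fun n => (Complex.abs_im_eq_norm.2 (hre n)).symm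
  have hbound : ∀ n y, ‖z n • resolventOp H (z n) y‖ ≤ ‖y‖ := fun n y => by
    rw [norm_smul, hnz]
    exact abs_im_mul_norm_resolventOp_le hH (him n) y
  have hdom : ∀ y ∈ H.domain, Tendsto (fun n => z n • resolventOp H (z n) y) atTop (𝓝 (-y)) := by
    intro y hy
    have hg : (y, H ⟨y, hy⟩) ∈ H.graph := H.mem_graph ⟨y, hy⟩
    have h0 : Tendsto (fun n => resolventOp H (z n) (H ⟨y, hy⟩)) atTop (𝓝 0) := by
      refine squeeze_zero_norm (a := fun n => ‖H ⟨y, hy⟩‖ * |(z n).im|⁻¹) (fun n => ?_) ?_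
      · rw [← div_eq_mul_inv, le_div_iff₀ (abs_pos.2 (him n)), mul_comm]
        exact abs_im_mul_norm_resolventOp_le hH (him n) _
      · simpa using hz.inv_tendsto_atTop.const_mul ‖H ⟨y, hy⟩‖
    have h1 := h0.sub_const y
    rw [zero_sub] at h1
    refine h1.congr fun n => ?_
    rw [resolventOp_apply_of_mem_graph hH (him n) hg, add_sub_cancel_left]
  rw [Metric.tendsto_atTop]
  intro ε hε
  obtain ⟨y, hy, hyD⟩ := Metric.dense_iff.1 hH.dense_domain x (ε / 3) (by positivity)
  obtain ⟨N, hN⟩ := Metric.tendsto_atTop.1 (hdom y hyD) (ε / 3) (by positivity)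
  refine ⟨N, fun n hn => ?_⟩
  have h1 := hN n hn
  rw [dist_eq_norm] at h1 ⊢
  rw [Metric.mem_ball, dist_comm, dist_eq_norm] at hy
  have e : z n • resolventOp H (z n) x - -x = z n • resolventOp H (z n) (x - y) +
      (z n • resolventOp H (z n) y - -y) + (x - y) := by
    rw [map_sub, smul_sub]; abel
  rw [e]
  calc _ ≤ ‖z n • resolventOp H (z n) (x - y)‖ + ‖z n • resolventOp H (z n) y - -y‖ + ‖x - y‖ :=
        (norm_add_le _ _).trans (by gcongr; exact norm_add_le _ _)
    _ < ε := by linarith [hbound n (x - y)]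

/-- The Yosida approximation `-i H c² (H² + c²)⁻¹` of `-iH`. -/
noncomputable def yosida (H : 𝓗 →ₗ.[ℂ] 𝓗) (c : ℝ) : 𝓗 →L[ℂ] 𝓗 :=
  (-Complex.I * (c ^ 2 / 2)) • (resolventOp H (c * Complex.I) + resolventOp H (-(c * Complex.I)))

theorem yosida_mem_skewAdjoint (hH : IsSelfAdjoint H) {c : ℝ} (hc : c ≠ 0) :
    yosida H c ∈ skewAdjoint (𝓗 →L[ℂ] 𝓗) := by
  rw [skewAdjoint.mem_iff, yosida, star_smul, star_add, adjoint_resolventOp hH (by simpa),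
    adjoint_resolventOp hH (by simpa), ← neg_smul]
  have e : star (-Complex.I * ((c : ℂ) ^ 2 / 2)) = -(-Complex.I * ((c : ℂ) ^ 2 / 2)) := by
    simp
  rw [e]
  simp only [map_neg, map_mul, Complex.conj_I, Complex.conj_ofReal, mul_neg, neg_neg]
  rw [add_comm]

theorem commute_yosida (hH : IsSelfAdjoint H) {c d : ℝ} (hc : c ≠ 0) (hd : d ≠ 0) :
    Commute (yosida H c) (yosida H d) := by
  have h : ∀ {z w : ℂ}, z.im ≠ 0 → w.im ≠ 0 → Commute (resolventOp H z) (resolventOp H w) :=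
    commute_resolventOp hH
  refine Commute.smul_left (Commute.smul_right ?_ _) _
  refine Commute.add_left (Commute.add_right ?_ ?_) (Commute.add_right ?_ ?_) <;>
    exact h (by simpa) (by simpa)

theorem tendsto_yosida_apply (hH : IsSelfAdjoint H) {c : ℕ → ℝ} (hc : ∀ n, 0 < c n)
    (hlim : Tendsto c atTop atTop) {x y : 𝓗} (h : (x, y) ∈ H.graph) :
    Tendsto (fun n => yosida H (c n) x) atTop (𝓝 (-Complex.I • y)) := by
  have hc' : ∀ n, c n ≠ 0 := fun n => (hc n).ne'
  have h1 := tendsto_smul_resolventOp hH (z := fun n => c n * Complex.I) (by simp) (by simpa)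
    (by simpa [abs_of_pos (hc _)] using hlim) y
  have h2 := tendsto_smul_resolventOp hH (z := fun n => -(c n * Complex.I)) (by simp) (by simpa)
    (by simpa [abs_of_pos (hc _)] using hlim) y
  -- With `z R(z) y = z x + z² R(z) x`, adding the values at `z = ±ic` cancels the terms `z x` and
  -- leaves `-c²` times the sum of resolvents, which is `yosida` after scaling by `i/2`.
  have h3 := (h1.add h2).const_smul (Complex.I / 2)
  have e : (Complex.I / 2) • (-y + -y) = -Complex.I • y := by
    rw [← neg_add, ← two_smul ℂ y, smul_neg, smul_smul, neg_smul]
    congr 2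
    ring
  rw [e] at h3
  refine h3.congr fun n => ?_
  have key : ∀ z : ℂ, z.im ≠ 0 →
      z • resolventOp H z y = z • x + z ^ 2 • resolventOp H z x := fun z hz => by
    rw [resolventOp_apply_of_mem_graph hH hz h, smul_add, smul_smul, pow_two]
  rw [key _ (by simpa using hc' n), key _ (by simpa using hc' n), yosida]
  have e1 : ((c n : ℂ) * Complex.I) ^ 2 = -(c n : ℂ) ^ 2 := by
    rw [mul_pow, Complex.I_sq]; ring
  rw [neg_sq, e1, smul_apply, add_apply]
  module

/-- **Stone's theorem**: a self-adjoint operator generates a unitary group. -/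
theorem exists_isUnitaryGroupOf (hH : IsSelfAdjoint H) :
    ∃ U : ℝ → 𝓗 →L[ℂ] 𝓗, IsUnitaryGroupOf H U := by
  have hpos : ∀ n : ℕ, (0 : ℝ) < n + 1 := fun n => by positivity
  have hlim : ∀ {x y : 𝓗}, (x, y) ∈ H.graph →
      Tendsto (fun n : ℕ => yosida H (n + 1) x) atTop (𝓝 (-Complex.I • y)) := fun h =>
    tendsto_yosida_apply hH hpos
      (tendsto_atTop_add_const_right _ _ tendsto_natCast_atTop_atTop) h
  obtain ⟨U, hunit, hzero, hadd, hcont, hderiv⟩ := exists_group_of_skewAdjoint_approx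
    (A := fun n : ℕ => yosida H (n + 1)) (fun n => yosida_mem_skewAdjoint hH (hpos n).ne')
    (fun m n => commute_yosida hH (hpos m).ne' (hpos n).ne') hH.dense_domain
    (fun x hx => ⟨_, hlim (H.mem_graph ⟨x, hx⟩)⟩)
  refine ⟨U, hunit, hzero, hadd, hcont, fun ψ η => ⟨fun h => hderiv _ _ (hlim h), fun h => ?_⟩⟩
  -- The generator can be no larger than `H`: differentiating `⟨U(-t)a, ψ⟩ = ⟨a, U(t)ψ⟩` at `0` puts
  -- `(ψ, η)` in the graph of `H* = H`.
  rw [mem_graph_iff_of_isSelfAdjoint hH]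
  intro a b hab
  have hstar : ∀ t, star (U t) = U (-t) := fun t => by
    have h1 : U t * U (-t) = 1 := by rw [← hadd, add_neg_cancel, hzero]
    rw [← mul_one (star (U t)), ← h1, ← mul_assoc, (Unitary.mem_iff.1 (hunit t)).1, one_mul]
  have h1 : HasDerivAt (fun t : ℝ => inner ℂ a (U t ψ)) (inner ℂ a (-Complex.I • η)) 0 :=
    ((innerSL ℂ a).restrictScalars ℝ).hasFDerivAt.comp_hasDerivAt (0 : ℝ) h
  have h2 : HasDerivAt (fun t : ℝ => U (-t) a) (Complex.I • b) 0 := by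
    have h3 : HasDerivAt (fun t => U t a) (-Complex.I • b) (-0) := by
      rw [neg_zero]; exact hderiv _ _ (hlim hab)
    have := h3.scomp (0 : ℝ) (hasDerivAt_neg (0 : ℝ))
    simpa [Function.comp_def] using this
  have h3 := h2.inner ℂ (hasDerivAt_const (0 : ℝ) ψ)
  have e : (fun t : ℝ => inner ℂ (U (-t) a) ψ) = fun t => inner ℂ a (U t ψ) := by
    funext t
    rw [← hstar, ContinuousLinearMap.star_eq_adjoint, ContinuousLinearMap.adjoint_inner_left]
  rw [e] at h3
  have h4 := h3.unique h1
  rw [inner_zero_right, zero_add, inner_smul_left, inner_smul_right, Complex.conj_I] at h4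
  exact mul_left_cancel₀ (neg_ne_zero.2 Complex.I_ne_zero) h4

theorem isUnitaryGroupOf_propagator (hH : IsSelfAdjoint H) :
    IsUnitaryGroupOf H (propagator H) := by
  have h := exists_isUnitaryGroupOf hH
  rw [propagator, dif_pos h]
  exact h.choose_spec

end Stone

/-! ### Plancherel for Hilbert-space-valued functions. -/

section Plancherel

open FourierTransform SchwartzMap

variable {V F : Type*} [NormedAddCommGroup V] [InnerProductSpace ℝ V] [FiniteDimensional ℝ V]
  [MeasurableSpace V] [BorelSpace V] [NormedAddCommGroup F] [InnerProductSpace ℂ F]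

theorem continuous_fourier_of_integrable {f : V → F} (hf : Integrable f) : Continuous (𝓕 f) :=
  VectorFourier.fourierIntegral_continuous Real.continuous_fourierChar
    (innerSL ℝ).continuous₂ hf

variable [CompleteSpace F]

/-- On `L¹ ∩ L²` the `L²` Fourier transform is given by the Fourier integral. -/
theorem coeFn_fourier_toLp_ae_eq {f : V → F} (hf : Integrable f) (hf2 : MemLp f 2) :
    ((𝓕 hf2.toLp : Lp (α := V) F 2) : V → F) =ᵐ[volume] 𝓕 f := by
  -- Both sides are tested against smooth compactly supported `g`; the transform moves onto `g`
  -- distributionally on the left and by Fubini on the right.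
  refine ae_eq_of_integral_contDiff_smul_eq ((Lp.memLp _).locallyIntegrable (by norm_num))
    (continuous_fourier_of_integrable hf).locallyIntegrable fun g hg hgc => ?_
  have hg₁ : HasCompactSupport (Complex.ofRealCLM ∘ g) := hgc.comp_left rfl
  have hg₂ : ContDiff ℝ (⊤ : ℕ∞) (Complex.ofRealCLM ∘ g) := Complex.ofRealCLM.contDiff.comp hg
  set G : 𝓢(V, ℂ) := hg₁.toSchwartzMap hg₂
  have hGg : ∀ x, G x = (g x : ℂ) := fun x => rfl
  have h1 := congrArg (fun T => T G) (Lp.fourier_toTemperedDistribution_eq hf2.toLp)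
  simp only [TemperedDistribution.fourier_apply, Lp.toTemperedDistribution_apply] at h1
  have h2 : ∫ x, 𝓕 G x • (hf2.toLp : Lp (α := V) F 2) x = ∫ x, 𝓕 G x • f x :=
    integral_congr_ae (by filter_upwards [hf2.coeFn_toLp] with x hx; rw [hx])
  have h3 : ∫ x, 𝓕 (G : V → ℂ) x • f x = ∫ x, G x • 𝓕 f x := by
    have := VectorFourier.integral_fourierIntegral_smul_eq_flip (μ := volume) (ν := volume)
      (L := innerₗ V) (f := (G : V → ℂ)) (g := f) Real.continuous_fourierChar
      continuous_inner G.integrable hf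
    rw [flip_innerₗ] at this
    exact this
  rw [h2, SchwartzMap.fourier_coe, h3] at h1
  simp only [hGg, Complex.coe_smul] at h1
  exact h1.symm

theorem eLpNorm_two_sq {α E : Type*} [MeasurableSpace α] [NormedAddCommGroup E] (μ : Measure α)
    (g : α → E) : eLpNorm g 2 μ ^ 2 = ∫⁻ x, ‖g x‖ₑ ^ 2 ∂μ := by
  have := eLpNorm_nnreal_pow_eq_lintegral (f := g) (μ := μ) (p := 2) two_ne_zero
  simpa using this

/-- **Plancherel's theorem** for functions in `L¹ ∩ L²` with values in a Hilbert space. -/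
theorem lintegral_enorm_fourier_sq {f : V → F} (hf : Integrable f) (hf2 : MemLp f 2) :
    ∫⁻ ξ, ‖𝓕 f ξ‖ₑ ^ 2 = ∫⁻ x, ‖f x‖ₑ ^ 2 := by
  rw [← eLpNorm_two_sq, ← eLpNorm_two_sq, ← eLpNorm_congr_ae (coeFn_fourier_toLp_ae_eq hf hf2),
    ← eLpNorm_congr_ae hf2.coeFn_toLp, ← Lp.enorm_def, ← Lp.enorm_def,
    ← ofReal_norm, ← ofReal_norm, Lp.norm_fourier_eq]

end Plancherel

/-! ### From the unitary group to the resolvent. -/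

section Laplace

variable {𝓗 : Type*} [NormedAddCommGroup 𝓗] [InnerProductSpace ℂ 𝓗] [CompleteSpace 𝓗]
  {H : 𝓗 →ₗ.[ℂ] 𝓗} {U : ℝ → 𝓗 →L[ℂ] 𝓗}

theorem IsUnitaryGroupOf.norm_apply (hU : IsUnitaryGroupOf H U) (t : ℝ) (x : 𝓗) :
    ‖U t x‖ = ‖x‖ :=
  ContinuousLinearMap.norm_map_of_mem_unitary (hU.unitary_mem t) x

theorem IsUnitaryGroupOf.hasDerivAt (hU : IsUnitaryGroupOf H U) {x y : 𝓗} (h : (x, y) ∈ H.graph)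
    (t : ℝ) : HasDerivAt (fun s => U s x) (-Complex.I • U t y) t := by
  have h1 : HasDerivAt (fun s => U t (U s x)) (-Complex.I • U t y) 0 := by
    have := ((U t).restrictScalars ℝ).hasFDerivAt.comp_hasDerivAt (0 : ℝ) ((hU.generator x y).1 h)
    simpa [Function.comp_def] using this
  have e : (fun s => U s x) = fun s => U t (U (s - t) x) := by
    funext s
    rw [← mul_apply_eq_comp, ← hU.map_add, add_sub_cancel]
  rw [e]
  exact HasDerivAt.comp_sub_const t t (f := fun s => U t (U s x)) (by simpa using h1)

theorem norm_exp_I_mul (z : ℂ) (t : ℝ) :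
    ‖Complex.exp (Complex.I * z * t)‖ = Real.exp (-z.im * t) := by
  rw [Complex.norm_exp]
  simp

theorem IsUnitaryGroupOf.integrableOn_exp_smul (hU : IsUnitaryGroupOf H U) {z : ℂ}
    (hz : 0 < z.im) (x : 𝓗) :
    IntegrableOn (fun t : ℝ => Complex.exp (Complex.I * z * t) • U t x) (Set.Ioi 0) := by
  refine Integrable.mono' ((integrableOn_exp_mul_Ioi (neg_lt_zero.2 hz) 0).mul_const ‖x‖) ?_ ?_
  · have := hU.strongly_continuous x
    exact (by fun_prop : Continuous fun t : ℝ =>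
      Complex.exp (Complex.I * z * t) • U t x).aestronglyMeasurable
  · refine Eventually.of_forall fun t => ?_
    rw [norm_smul, norm_exp_I_mul, hU.norm_apply]

/-- The resolvent of `H` is the Laplace transform of its unitary group. -/
theorem IsUnitaryGroupOf.integral_exp_smul (hU : IsUnitaryGroupOf H U) (hH : IsSelfAdjoint H)
    {z : ℂ} (hz : 0 < z.im) (x : 𝓗) :
    ∫ t in Set.Ioi (0 : ℝ), Complex.exp (Complex.I * z * t) • U t x =
      -Complex.I • resolventOp H z x := by
  set u := resolventOp H z x
  have hg : (u, x + z • u) ∈ H.graph := resolventOp_mem_graph hH hz.ne' x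
  -- An explicit primitive: since `Hu = x + zu`, the two terms in `zu` cancel on differentiation.
  have hderiv : ∀ t ∈ Set.Ici (0 : ℝ), HasDerivAt
      (fun t : ℝ => Complex.I • Complex.exp (Complex.I * z * t) • U t u)
      (Complex.exp (Complex.I * z * t) • U t x) t := by
    intro t _
    have h1 : HasDerivAt (fun t : ℝ => Complex.exp (Complex.I * z * t))
        (Complex.exp (Complex.I * z * t) * (Complex.I * z)) t := by
      have := ((hasDerivAt_id (t : ℂ)).const_mul (Complex.I * z)).cexp.comp_ofReal
      simpa using this
    have h2 := (h1.smul (hU.hasDerivAt hg t)).const_smul Complex.I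
    refine HasDerivAt.congr_deriv h2 ?_
    rw [_root_.map_add, map_smul]
    simp only [smul_add, smul_smul]
    have e1 : Complex.I * (Complex.exp (Complex.I * z * t) * -Complex.I) =
        Complex.exp (Complex.I * z * t) := by
      linear_combination -Complex.exp (Complex.I * z * t) * Complex.I_mul_I
    have e2 : Complex.I * (Complex.exp (Complex.I * z * t) * (Complex.I * z)) =
        -(Complex.exp (Complex.I * z * t) * z) := by
      linear_combination Complex.exp (Complex.I * z * t) * z * Complex.I_mul_I
    simp only [← mul_assoc] at e1 e2 ⊢
    rw [e1, e2, neg_smul]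
    abel
  have hlim : Tendsto (fun t : ℝ => Complex.I • Complex.exp (Complex.I * z * t) • U t u)
      atTop (𝓝 0) := by
    rw [tendsto_zero_iff_norm_tendsto_zero]
    simp only [norm_smul, Complex.norm_I, one_mul, norm_exp_I_mul, hU.norm_apply]
    have : Tendsto (fun t : ℝ => Real.exp (-z.im * t)) atTop (𝓝 0) :=
      Real.tendsto_exp_atBot.comp (tendsto_id.const_mul_atTop_of_neg (neg_lt_zero.2 hz))
    simpa using this.mul_const ‖u‖
  rw [integral_Ioi_of_hasDerivAt_of_tendsto' hderiv (hU.integrableOn_exp_smul hz x) hlim]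
  simp [hU.map_zero]

variable {F : Type*} [NormedAddCommGroup F] [InnerProductSpace ℂ F] [CompleteSpace F]

open FourierTransform in
theorem IsUnitaryGroupOf.lintegral_exp_mul_enorm_sq (hU : IsUnitaryGroupOf H U)
    (hH : IsSelfAdjoint H) (A : 𝓗 →L[ℂ] F) {ε : ℝ} (hε : 0 < ε) (x : 𝓗) :
    ∫⁻ t in Set.Ioi (0 : ℝ), ENNReal.ofReal (Real.exp (-(2 * ε * t))) * ‖A (U t x)‖ₑ ^ 2 =
      ENNReal.ofReal (1 / (2 * Real.pi)) *
        ∫⁻ E : ℝ, ‖A (resolventOp H (E + ε * Complex.I) x)‖ₑ ^ 2 := by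
  have hcont := hU.strongly_continuous x
  let f : ℝ → F := (Set.Ioi (0 : ℝ)).indicator fun t => (Real.exp (-ε * t) : ℂ) • A (U t x)
  have hmeas : AEStronglyMeasurable f volume :=
    (by fun_prop : Continuous fun t : ℝ =>
      (Real.exp (-ε * t) : ℂ) • A (U t x)).aestronglyMeasurable.indicator measurableSet_Ioi
  have hbound : ∀ t, ‖(Real.exp (-ε * t) : ℂ) • A (U t x)‖ ≤ Real.exp (-ε * t) * (‖A‖ * ‖x‖) := by
    intro t
    rw [norm_smul, Complex.norm_real, Real.norm_of_nonneg (Real.exp_pos _).le]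
    gcongr
    rw [← hU.norm_apply t x]
    exact A.le_opNorm _
  have hf : Integrable f := by
    rw [integrable_indicator_iff measurableSet_Ioi]
    refine Integrable.mono' ((integrableOn_exp_mul_Ioi (neg_lt_zero.2 hε) 0).mul_const
      (‖A‖ * ‖x‖)) ?_ (Eventually.of_forall hbound)
    exact (by fun_prop : Continuous fun t : ℝ =>
      (Real.exp (-ε * t) : ℂ) • A (U t x)).aestronglyMeasurable
  have hf2 : MemLp f 2 := by
    -- `f` is integrable and bounded by `‖A‖ * ‖x‖`, hence square integrable.
    refine (memLp_two_iff_integrable_sq_norm hmeas).2 ?_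
    refine (hf.norm.const_mul (‖A‖ * ‖x‖)).mono' (hmeas.norm.pow 2)
      (Eventually.of_forall fun t => ?_)
    rw [Real.norm_of_nonneg (sq_nonneg _), pow_two]
    refine mul_le_mul_of_nonneg_right ?_ (norm_nonneg _)
    by_cases ht : t ∈ Set.Ioi (0 : ℝ)
    · simp only [f, Set.indicator_of_mem ht]
      refine (hbound t).trans (mul_le_of_le_one_left (by positivity) ?_)
      have : 0 < t := ht
      exact Real.exp_le_one_iff.2 (by nlinarith)
    · simp only [f, Set.indicator_of_notMem ht, norm_zero]
      positivity
  have hfourier : ∀ w : ℝ, ‖𝓕 f w‖ₑ =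
      ‖A (resolventOp H (((-2 * Real.pi * w : ℝ) : ℂ) + ε * Complex.I) x)‖ₑ := by
    intro w
    set z : ℂ := ((-2 * Real.pi * w : ℝ) : ℂ) + ε * Complex.I with hz
    have hzim : 0 < z.im := by simpa [hz] using hε
    have h1 : 𝓕 f w = A (∫ t in Set.Ioi (0 : ℝ), Complex.exp (Complex.I * z * t) • U t x) := by
      rw [Real.fourier_real_eq_integral_exp_smul,
        ← A.integral_comp_comm (hU.integrableOn_exp_smul hzim x),
        ← integral_indicator measurableSet_Ioi]
      congr 1
      funext t
      by_cases ht : t ∈ Set.Ioi (0 : ℝ)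
      · simp only [f, Set.indicator_of_mem ht, map_smul, smul_smul]
        congr 1
        rw [Complex.ofReal_exp, ← Complex.exp_add]
        congr 1
        rw [hz]
        push_cast
        linear_combination -(ε : ℂ) * t * Complex.I_mul_I
      · simp only [f, Set.indicator_of_notMem ht, smul_zero]
    rw [h1, hU.integral_exp_smul hH hzim, map_smul, ← ofReal_norm, norm_smul, norm_neg,
      Complex.norm_I, one_mul, ofReal_norm]
  have hP := lintegral_enorm_fourier_sq hf hf2
  simp only [hfourier] at hP
  -- The Fourier kernel is `e^{-2πitw}`, so the factor `1/(2π)` is the Jacobian of `E = -2πw`.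
  have hscale : ∀ g : ℝ → ENNReal, ∫⁻ w, g (-2 * Real.pi * w) =
      ENNReal.ofReal (1 / (2 * Real.pi)) * ∫⁻ E, g E := by
    intro g
    have ha : (-2 * Real.pi : ℝ) ≠ 0 := by simp [Real.pi_ne_zero]
    have hm := Real.map_volume_mul_left ha
    have hemb := (Homeomorph.mulLeft₀ _ ha).measurableEmbedding.lintegral_map (μ := volume) g
    simp only [Homeomorph.coe_mulLeft₀] at hemb
    rw [← hemb, hm, lintegral_smul_measure, smul_eq_mul]
    congr 2
    rw [abs_inv, abs_mul, abs_of_pos Real.pi_pos]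
    norm_num
  rw [hscale fun E => ‖A (resolventOp H ((E : ℂ) + ε * Complex.I) x)‖ₑ ^ 2] at hP
  rw [hP, ← lintegral_indicator measurableSet_Ioi]
  refine lintegral_congr fun t => ?_
  by_cases ht : t ∈ Set.Ioi (0 : ℝ)
  · simp only [f, Set.indicator_of_mem ht, enorm_smul, mul_pow]
    congr 1
    rw [← ofReal_norm, Complex.norm_real, Real.norm_of_nonneg (Real.exp_pos _).le,
      ← ENNReal.ofReal_pow (Real.exp_pos _).le, ← Real.exp_nat_mul]
    congr 2
    push_cast
    ring
  · simp only [f, Set.indicator_of_notMem ht, enorm_zero]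
    simp

end Laplace

/-- The resolvent identity gives the Lipschitz constant `‖x‖/ε²`. Continuity supplies the
measurability in `E` that monotone convergence needs. -/
theorem continuous_resolventOp_apply {𝓗 : Type*} [NormedAddCommGroup 𝓗] [InnerProductSpace ℂ 𝓗]
    [CompleteSpace 𝓗] {H : 𝓗 →ₗ.[ℂ] 𝓗} (hH : IsSelfAdjoint H) {ε : ℝ} (hε : 0 < ε) (x : 𝓗) :
    Continuous fun E : ℝ => resolventOp H (E + ε * Complex.I) x := by
  have him : ∀ E : ℝ, ((E : ℂ) + ε * Complex.I).im = ε := fun E => by simp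
  have hne : ∀ E : ℝ, ((E : ℂ) + ε * Complex.I).im ≠ 0 := fun E => by rw [him]; exact hε.ne'
  have hb : ∀ (E : ℝ) (y : 𝓗), ‖resolventOp H (E + ε * Complex.I) y‖ ≤ ‖y‖ / ε := fun E y => by
    rw [le_div_iff₀ hε, mul_comm]
    simpa only [him, abs_of_pos hε] using abs_im_mul_norm_resolventOp_le hH (hne E) y
  refine (LipschitzWith.of_dist_le_mul (K := (‖x‖ / ε / ε).toNNReal) fun E E' => ?_).continuous
  rw [Real.coe_toNNReal _ (by positivity)]
  have h := resolventOp_apply_of_mem_graph hH (hne E) (resolventOp_mem_graph hH (hne E') x)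
  have h1 : resolventOp H (E + ε * Complex.I) x - resolventOp H (E' + ε * Complex.I) x =
      ((E - E' : ℝ) : ℂ) •
        resolventOp H (E + ε * Complex.I) (resolventOp H (E' + ε * Complex.I) x) := by
    rw [map_add, map_smul] at h
    rw [eq_sub_of_add_eq h, Complex.ofReal_sub]
    module
  rw [dist_eq_norm, h1, norm_smul, Complex.norm_real, dist_eq_norm, mul_comm]
  gcongr
  refine (hb _ _).trans ?_
  gcongr
  exact hb _ _

/-! ### Weights and their bounded truncations. -/

theorem IsWeight.measurable {φ : R3 → ℝ} (hφ : IsWeight φ) : Measurable φ := by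
  let e : R3 := EuclideanSpace.single 0 1
  have he : ∀ r : ℝ, ‖r • e‖ = |r| := fun r => by simp [e, norm_smul]
  -- `φ` is radial, by monotonicity in both directions. Its profile is frozen on `r < 0` so as to be
  -- monotone on all of `ℝ`.
  have hmono : Monotone fun r : ℝ => φ (max r 0 • e) := fun r s hrs => by
    refine hφ.mono _ _ ?_
    rw [he, he, abs_of_nonneg (le_max_right _ _), abs_of_nonneg (le_max_right _ _)]
    exact max_le_max_right 0 hrs
  have h : φ = (fun r : ℝ => φ (max r 0 • e)) ∘ fun x => ‖x‖ := by
    funext x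
    have hx : ‖max ‖x‖ 0 • e‖ = ‖x‖ := by
      rw [he, max_eq_left (norm_nonneg x), abs_of_nonneg (norm_nonneg x)]
    exact le_antisymm (hφ.mono _ _ hx.ge) (hφ.mono _ _ hx.le)
  rw [h]
  exact hmono.measurable.comp measurable_norm

theorem sqrtWeightNorm_sq {φ : R3 → ℝ} (hφ : ∀ x, 0 ≤ φ x) (u : L2R3) :
    sqrtWeightNorm φ u ^ 2 = weightExpectation φ u := by
  rw [sqrtWeightNorm, eLpNorm_two_sq, weightExpectation]
  refine lintegral_congr fun x => ?_
  rw [← ofReal_norm, ← ENNReal.ofReal_pow (norm_nonneg _), norm_mul, mul_pow, Complex.norm_real,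
    Real.norm_of_nonneg (Real.sqrt_nonneg _), Real.sq_sqrt (hφ x)]

/-- Multiplication by the square root of a bounded nonnegative function is a bounded operator. -/
theorem exists_enorm_sq_eq_weightExpectation {g : R3 → ℝ} (hg : Measurable g) (hg0 : ∀ x, 0 ≤ g x)
    {C : ℝ} (hC : ∀ x, g x ≤ C) :
    ∃ A : L2R3 →L[ℂ] L2R3, ∀ u, ‖A u‖ₑ ^ 2 = weightExpectation g u := by
  have hm : MemLp (fun x => (Real.sqrt (g x) : ℂ)) ⊤ (volume : Measure R3) := by
    refine memLp_top_of_bound (C := Real.sqrt C)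
      (Complex.measurable_ofReal.comp hg.sqrt).aestronglyMeasurable
      (Eventually.of_forall fun x => ?_)
    rw [Complex.norm_real, Real.norm_of_nonneg (Real.sqrt_nonneg _)]
    exact Real.sqrt_le_sqrt (hC x)
  refine ⟨(ContinuousLinearMap.lsmul ℂ ℂ).holderL volume ⊤ 2 2 hm.toLp, fun u => ?_⟩
  rw [← sqrtWeightNorm_sq hg0, Lp.enorm_def, sqrtWeightNorm]
  congr 1
  refine eLpNorm_congr_ae ?_
  filter_upwards [(ContinuousLinearMap.lsmul ℂ ℂ).coeFn_holder (r := 2) hm.toLp u,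
    hm.coeFn_toLp] with x hx hx'
  change ((ContinuousLinearMap.lsmul ℂ ℂ).holder 2 hm.toLp u) x = _
  rw [hx, hx']
  rfl

theorem monotone_weightExpectation_min (φ : R3 → ℝ) (u : L2R3) :
    Monotone fun n : ℕ => weightExpectation (fun x => min (φ x) n) u := fun m n hmn =>
  lintegral_mono fun x => ENNReal.ofReal_le_ofReal (by dsimp only; gcongr)

theorem iSup_weightExpectation_min {φ : R3 → ℝ} (hφ : Measurable φ) (u : L2R3) :
    ⨆ n : ℕ, weightExpectation (fun x => min (φ x) n) u = weightExpectation φ u := by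
  simp only [weightExpectation]
  rw [← lintegral_iSup']
  · refine lintegral_congr fun x => le_antisymm (iSup_le fun n => ?_) ?_
    · exact ENNReal.ofReal_le_ofReal (by gcongr; exact min_le_left _ _)
    · obtain ⟨n, hn⟩ := exists_nat_ge (φ x)
      refine le_iSup_of_le n ?_
      rw [min_eq_left hn]
  · intro n
    have := (Lp.aestronglyMeasurable u).norm.aemeasurable
    exact (((hφ.min measurable_const).aemeasurable).mul (this.pow_const 2)).ennreal_ofReal
  · exact Eventually.of_forall fun x m n hmn => ENNReal.ofReal_le_ofReal (by gcongr)

end QuantumTransport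

open QuantumTransport in
theorem theorem2p2
    (H : QuantumTransport.L2R3 →ₗ.[ℂ] QuantumTransport.L2R3) (hH : IsSelfAdjoint H)
    (φ : QuantumTransport.R3 → ℝ) (hφ : QuantumTransport.IsWeight φ)
    (T : ℝ) (hT : 0 < T) (ψ : QuantumTransport.L2R3) :
    QuantumTransport.averagedMoment H φ ψ T =
      ENNReal.ofReal (1 / (2 * Real.pi * T)) *
        ∫⁻ E : ℝ, QuantumTransport.sqrtWeightNorm φ
          (QuantumTransport.resolventOp H ((E : ℂ) + Complex.I / (2 * (T : ℂ))) ψ) ^ 2 := by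
  have hU := isUnitaryGroupOf_propagator hH
  -- Half the decay rate `1/T`, because the amplitude gets squared.
  have hε : 0 < 1 / (2 * T) := by positivity
  have hmeas := hφ.measurable
  have hA : ∀ n : ℕ, ∃ A : L2R3 →L[ℂ] L2R3, ∀ u, ‖A u‖ₑ ^ 2 =
      weightExpectation (fun x => min (φ x) n) u := fun n =>
    exists_enorm_sq_eq_weightExpectation (hmeas.min measurable_const)
      (fun x => le_min (hφ.nonneg x) n.cast_nonneg) (fun x => min_le_right _ _)
  choose A hA using hA
  have hsup : ∀ u, weightExpectation φ u = ⨆ n, ‖A n u‖ₑ ^ 2 := fun u => by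
    simp only [hA, iSup_weightExpectation_min hmeas]
  have hmono : ∀ u, Monotone fun n => ‖A n u‖ₑ ^ 2 := fun u => by
    simp only [hA]
    exact monotone_weightExpectation_min φ u
  have hz : ∀ E : ℝ, (E : ℂ) + Complex.I / (2 * (T : ℂ)) =
      E + ((1 / (2 * T) : ℝ) : ℂ) * Complex.I := fun E => by
    push_cast
    ring
  have hexp : ∀ t : ℝ, Real.exp (-(t / T)) = Real.exp (-(2 * (1 / (2 * T)) * t)) := fun t => by
    congr 2
    field_simp
  have hcU := hU.strongly_continuous ψ
  have hcR := continuous_resolventOp_apply hH hε ψ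
  simp only [averagedMoment, sqrtWeightNorm_sq hφ.nonneg, hsup, hz, hexp, ENNReal.mul_iSup]
  rw [lintegral_iSup, lintegral_iSup]
  · simp only [hU.lintegral_exp_mul_enorm_sq hH _ hε, ENNReal.mul_iSup, ← mul_assoc]
    rw [← ENNReal.ofReal_mul (by positivity), one_div_mul_one_div, mul_comm T]
  · exact fun n => ((A n).continuous.comp hcR).enorm.measurable.pow_const 2
  · exact fun m n hmn E => hmono _ hmn
  · refine fun n => Measurable.mul ?_ (((A n).continuous.comp hcU).enorm.measurable.pow_const 2)
    fun_prop
  · exact fun m n hmn t => mul_le_mul_right (hmono _ hmn) _
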